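/- Let $\mathbb D=\{z\in\mathbb C:|z|<1\}$. For $1\le q\le\infty$ let $H^q$ be the Hardy space of the functions $f$ holomorphic in $\mathbb D$ with $\|f\|_q<\infty$, where $\|f\|_\infty=\sup_{z\in\mathbb D}|f(z)|$ and $\|f\|_q=\sup_{0<\rho<1}\left(\frac1{2\pi}\int_0^{2\pi}|f(\rho e^{i\theta})|^q\,d\theta\right)^{1/q}$ for $q<\infty$. For $n\in\{0,1,2,\dots\}$ and $f\in H^q$ let $E_n(f)_q=\inf_P\|f-P\|_q$, where $P$ runs over the complex algebraic polynomials of degree at most $n-1$ (for $n=0$ only $P=0$ is admitted, so $E_0(f)_q=\|f\|_q$). An operator $T$ is called a best approximation-preserving (BAP) operator over $H^q$ (of order $n$) if it is a bounded linear operator from $H^q$ into $H^q$, $T(e_n)=e_n$ for $e_n(z)=z^n$, and $\|T(f)\|_q\le E_n(f)_q$ for all $f\in H^q$. The Hadamard product of two functions $f(z)=\sum_{k\ge0}\widehat f_kz^k$ and $g(z)=\sum_{k\ge0}\widehat g_kz^k$ holomorphic in $\mathbb D$ is $(f*g)(z)=\sum_{k\ge0}\widehat f_k\widehat g_kz^k$.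 **Theorem.** Let $n\in\{0,1,2,\dots\}$, let $K_n$ be holomorphic in $\mathbb D$ with $K_n(z)=z^n+O(z^{n+1})$ as $z\to0$, and let $T_n(f)=K_n*f$. Then $T_n$ is a BAP operator over $H^\infty$ if and only if $$K_n(z)=z^n+O(z^{2n+1})\ \text{ as } z\to0\qquad\text{and}\qquad \mathrm{Re}\,\frac{K_n(z)}{z^n}\ge\frac12\ \text{ for all } z\in\mathbb D,$$ where at $z=0$ the quotient $K_n(z)/z^n$ is understood as its limit $1$. Moreover, these two conditions imply that $T_n$ is a BAP operator over $H^q$ for every $q$ with $1\le q\le\infty$. -/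

import Mathlib

open scoped ENNReal NNReal Topology Asymptotics
open Polynomial (degreeLT)

namespace HadamardBAP

/-- The open unit disc. -/
def disc : Set ℂ := Metric.ball 0 1

/-- The norm of the Hardy space of exponent `q`, as an extended nonnegative number. For finite `q`
it is the supremum over `0 < ρ < 1` of the `q`-means over the circle of radius `ρ`, taken with
respect to the normalized arc length; for `q = ∞` it is the supremum over the disc. -/
noncomputable def hardyNorm (q : ℝ≥0∞) (f : ℂ → ℂ) : ℝ≥0∞ :=
  if q = ∞ then ⨆ z ∈ disc, ‖f z‖ₑ
  else ⨆ ρ ∈ Set.Ioo (0 : ℝ) 1,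
    ((∫⁻ θ in Set.Ioc (0 : ℝ) (2 * Real.pi), ‖f (circleMap 0 ρ θ)‖ₑ ^ q.toReal) /
      ENNReal.ofReal (2 * Real.pi)) ^ (1 / q.toReal)

/-- Membership in the Hardy space of exponent `q`: holomorphic in the disc, of finite norm.
Only the values in the disc matter. -/
def MemHardy (q : ℝ≥0∞) (f : ℂ → ℂ) : Prop :=
  DifferentiableOn ℂ f disc ∧ hardyNorm q f < ∞

/-- The best approximation of `f` by polynomials of degree at most `n - 1`. For `n = 0` the only
admissible polynomial is `0`, so that the value is `hardyNorm q f`. -/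
noncomputable def bestApprox (n : ℕ) (q : ℝ≥0∞) (f : ℂ → ℂ) : ℝ≥0∞ :=
  ⨅ P ∈ degreeLT ℂ n, hardyNorm q (fun z => f z - P.eval z)

/-- The Taylor coefficient of index `k` at the origin. -/
noncomputable def taylorCoeff (f : ℂ → ℂ) (k : ℕ) : ℂ :=
  iteratedDeriv k f 0 / (Nat.factorial k : ℂ)

/-- The Hadamard product `f * g`; the series converges in the disc if `f` and `g` are holomorphic
there. -/
noncomputable def hadamard (f g : ℂ → ℂ) : ℂ → ℂ :=
  fun z => ∑' k : ℕ, taylorCoeff f k * taylorCoeff g k * z ^ k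

/-- `T` is a best approximation-preserving operator over the Hardy space of exponent `q`: a bounded
linear operator of this space into itself that fixes `z ^ n` and satisfies
`‖T f‖ ≤ Eₙ(f)` for every `f` of the space. Functions are compared in the disc only. -/
structure IsBAP (n : ℕ) (q : ℝ≥0∞) (T : (ℂ → ℂ) → ℂ → ℂ) : Prop where
  mapsTo : ∀ f, MemHardy q f → MemHardy q (T f)
  map_add : ∀ f g, MemHardy q f → MemHardy q g →
    Set.EqOn (T (fun z => f z + g z)) (fun z => T f z + T g z) disc
  map_smul : ∀ (c : ℂ) (f), MemHardy q f →
    Set.EqOn (T (fun z => c * f z)) (fun z => c * T f z) disc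
  bounded : ∃ C : ℝ≥0, ∀ f, MemHardy q f → hardyNorm q (T f) ≤ C * hardyNorm q f
  map_monomial : Set.EqOn (T (fun z => z ^ n)) (fun z => z ^ n) disc
  norm_le : ∀ f, MemHardy q f → hardyNorm q (T f) ≤ bestApprox n q f

/-- The condition on the kernel: `K z = z ^ n + O(z ^ (2 n + 1))` as `z → 0`, and
`Re (K z / z ^ n) ≥ 1 / 2` in the disc. At `z = 0` the quotient stands for its limit `1`, so that
nothing is required there. -/
def KernelCondition (n : ℕ) (K : ℂ → ℂ) : Prop :=
  ((fun z => K z - z ^ n) =O[𝓝 0] fun z => z ^ (2 * n + 1)) ∧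
    ∀ z ∈ disc, z ≠ 0 → 1 / 2 ≤ (K z / z ^ n).re

end HadamardBAP

namespace HadamardBAP

/-! Sufficiency. On the circle of radius `r` the kernel `K` may be altered at negative frequencies
without changing the Hadamard product, since a holomorphic `f` has none. Adding the reflection
`e^(2int) conj K` and subtracting `r^n e^(int)` turns `K` into `r^n e^(int) (2 Re (K/z^n) - 1)`. The
gap up to degree `2n` says that no coefficient of nonnegative index changes
(`integral_circleKernel_mul_expI`); the bound on the real part makes the last factor nonnegative, so
the mean of the modulus is just `r^n ≤ 1` (`lintegral_enorm_circleKernel`). Hence the operator is an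
average of rotations with a complex weight of total mass at most one, so a contraction for every `q
≥ 1`. It kills polynomials of degree below `n`, which upgrades the bound to the best approximation.

Necessity uses only contractivity on bounded functions, tested near the fixed point `z^n`. A
perturbation `z^n (1 - ε g)` with `Re g ≥ 0` has norm at most `1 + O(ε²)`, so the image cannot grow
to first order in `ε`. Purely imaginary `g` on the unit circle gives the gap
(`IsBAP.taylorCoeff_eq_zero`); the Cayley-type `g = (1 + rz)/(1 - rz)` gives the real part
(`IsBAP.half_le_re`). -/

theorem isOpen_disc : IsOpen disc := Metric.isOpen_ball

theorem mem_disc {z : ℂ} : z ∈ disc ↔ ‖z‖ < 1 := by simp [disc]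

theorem disc_mem_nhds : disc ∈ 𝓝 (0 : ℂ) := isOpen_disc.mem_nhds (by simp [mem_disc])

/-! ### Taylor coefficients. -/

/-- A function holomorphic in the disc is the sum of its Taylor series. -/
theorem hasSum_taylorCoeff {f : ℂ → ℂ} (hf : DifferentiableOn ℂ f disc) {z : ℂ} (hz : z ∈ disc) :
    HasSum (fun k => taylorCoeff f k * z ^ k) (f z) := by
  have h := Complex.hasSum_taylorSeries_on_ball (c := 0) (r := 1) hf hz
  have he : (fun k => taylorCoeff f k * z ^ k) = fun k : ℕ =>
      (k.factorial : ℂ)⁻¹ • (z - 0) ^ k • iteratedDeriv k f 0 := by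
    funext k
    simp only [taylorCoeff, sub_zero, smul_eq_mul]
    ring
  rw [he]
  exact h

/-- The coefficients of a power series that converges near the origin are the Taylor coefficients
of its sum. -/
theorem taylorCoeff_eq_of_hasSum {f : ℂ → ℂ} {a : ℕ → ℂ}
    (h : ∀ᶠ z in 𝓝 (0 : ℂ), HasSum (fun k => a k * z ^ k) (f z)) (k : ℕ) :
    taylorCoeff f k = a k := by
  have hp : HasFPowerSeriesAt f (FormalMultilinearSeries.ofScalars ℂ a) 0 := by
    rw [hasFPowerSeriesAt_iff]
    filter_upwards [h] with z hz
    simpa [FormalMultilinearSeries.coeff_ofScalars, mul_comm] using hz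
  have he := hp.eq_formalMultilinearSeries hp.analyticAt.hasFPowerSeriesAt
  have := congrArg (fun p => FormalMultilinearSeries.coeff p k) he
  simpa [FormalMultilinearSeries.coeff_ofScalars, taylorCoeff] using this.symm

theorem summable_norm_taylorCoeff {f : ℂ → ℂ} (hf : DifferentiableOn ℂ f disc) {r : ℝ}
    (hr0 : 0 ≤ r) (hr : r < 1) : Summable fun k => ‖taylorCoeff f k‖ * r ^ k := by
  have h : (r : ℂ) ∈ disc := by simpa [mem_disc, abs_of_nonneg hr0] using hr
  have := (hasSum_taylorCoeff hf h).summable.norm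
  simpa [abs_of_nonneg hr0] using this

theorem taylorCoeff_add {f g : ℂ → ℂ} (hf : DifferentiableOn ℂ f disc)
    (hg : DifferentiableOn ℂ g disc) (k : ℕ) :
    taylorCoeff (fun z => f z + g z) k = taylorCoeff f k + taylorCoeff g k := by
  refine taylorCoeff_eq_of_hasSum (a := fun k => taylorCoeff f k + taylorCoeff g k) ?_ k
  filter_upwards [disc_mem_nhds] with z hz
  simpa [add_mul] using (hasSum_taylorCoeff hf hz).add (hasSum_taylorCoeff hg hz)

theorem taylorCoeff_const_mul {f : ℂ → ℂ} (hf : DifferentiableOn ℂ f disc) (c : ℂ) (k : ℕ) :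
    taylorCoeff (fun z => c * f z) k = c * taylorCoeff f k := by
  refine taylorCoeff_eq_of_hasSum (a := fun k => c * taylorCoeff f k) ?_ k
  filter_upwards [disc_mem_nhds] with z hz
  simpa [mul_assoc] using (hasSum_taylorCoeff hf hz).mul_left c

theorem taylorCoeff_sub {f g : ℂ → ℂ} (hf : DifferentiableOn ℂ f disc)
    (hg : DifferentiableOn ℂ g disc) (k : ℕ) :
    taylorCoeff (fun z => f z - g z) k = taylorCoeff f k - taylorCoeff g k := by
  refine taylorCoeff_eq_of_hasSum (a := fun k => taylorCoeff f k - taylorCoeff g k) ?_ k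
  filter_upwards [disc_mem_nhds] with z hz
  simpa [sub_mul] using (hasSum_taylorCoeff hf hz).sub (hasSum_taylorCoeff hg hz)

theorem taylorCoeff_pow (n k : ℕ) :
    taylorCoeff (fun z => z ^ n) k = if k = n then 1 else 0 := by
  refine taylorCoeff_eq_of_hasSum (a := fun k => if k = n then 1 else 0) ?_ k
  refine .of_forall fun z => ?_
  convert hasSum_single (f := fun k => (if k = n then (1 : ℂ) else 0) * z ^ k) n ?_ using 1
  · simp
  · intro b hb
    simp [hb]

theorem taylorCoeff_polynomial (P : Polynomial ℂ) (k : ℕ) :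
    taylorCoeff (fun z => P.eval z) k = P.coeff k := by
  refine taylorCoeff_eq_of_hasSum (.of_forall fun z => ?_) k
  rw [Polynomial.eval_eq_sum_range]
  refine hasSum_sum_of_ne_finset_zero fun b hb => ?_
  rw [Polynomial.coeff_eq_zero_of_natDegree_lt (by simpa [Nat.lt_succ_iff] using hb), zero_mul]

/-- If the order `k` at the origin were below `m`, then `f = z^k g` with `g 0 ≠ 0`, while the bound
gives `‖g z‖ ≤ C ‖z‖^(m-k)`, which tends to `0`. This turns both growth conditions on `K` into
vanishing of coefficients. -/
theorem isBigO_pow_iff_taylorCoeff {f : ℂ → ℂ} (hf : DifferentiableOn ℂ f disc) (m : ℕ) :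
    (f =O[𝓝 0] fun z => z ^ m) ↔ ∀ k < m, taylorCoeff f k = 0 := by
  have ha : AnalyticAt ℂ f 0 := hf.analyticAt disc_mem_nhds
  have hiff : (∀ k < m, taylorCoeff f k = 0) ↔ (m : ℕ∞) ≤ analyticOrderAt f 0 := by
    rw [natCast_le_analyticOrderAt_iff_iteratedDeriv_eq_zero ha]
    simp [taylorCoeff, Nat.factorial_ne_zero]
  rw [hiff]
  constructor
  · intro h
    by_contra! hlt
    obtain ⟨k, hk⟩ := ENat.ne_top_iff_exists.1 hlt.ne_top
    obtain ⟨g, hg, hg0, hfg⟩ := (ha.analyticOrderAt_eq_natCast).1 hk.symm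
    have hkm : k < m := by rw [← hk] at hlt; exact_mod_cast hlt
    obtain ⟨C, hC⟩ := h.bound
    have hlim : Filter.Tendsto (fun z : ℂ => C * ‖z‖ ^ (m - k)) (𝓝[≠] 0) (𝓝 0) := by
      have : ContinuousAt (fun z : ℂ => C * ‖z‖ ^ (m - k)) 0 := by fun_prop
      have h2 := this.tendsto
      simp only [norm_zero, zero_pow (Nat.sub_ne_zero_of_lt hkm), mul_zero] at h2
      exact h2.mono_left nhdsWithin_le_nhds
    have hle : ‖g 0‖ ≤ 0 := by
      refine le_of_tendsto_of_tendsto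
        (hg.continuousAt.norm.tendsto.mono_left (nhdsWithin_le_nhds (s := {0}ᶜ))) hlim ?_
      filter_upwards [nhdsWithin_le_nhds hC, nhdsWithin_le_nhds hfg, self_mem_nhdsWithin]
        with z hz1 hz2 hz3
      have hz : 0 < ‖z‖ ^ k := pow_pos (norm_pos_iff.2 hz3) k
      rw [hz2] at hz1
      simp only [sub_zero, smul_eq_mul, norm_mul, norm_pow] at hz1
      rw [← Nat.sub_add_cancel hkm.le, pow_add, ← mul_assoc, mul_comm] at hz1
      exact le_of_mul_le_mul_right hz1 hz
    exact hg0 (norm_le_zero_iff.1 hle)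
  · intro h
    obtain ⟨g, hg, hfg⟩ := (natCast_le_analyticOrderAt ha).1 h
    refine (Filter.EventuallyEq.trans_isBigO hfg ?_)
    have := (Asymptotics.isBigO_refl (fun z : ℂ => z ^ m) (𝓝 0)).mul
      (hg.continuousAt.isBigO_one (F := ℂ))
    simpa using this

/-! ### The Hadamard product. -/

theorem summable_norm_taylorCoeff_mul {f g : ℂ → ℂ} (hf : DifferentiableOn ℂ f disc)
    (hg : DifferentiableOn ℂ g disc) {s : ℝ} (hs0 : 0 ≤ s) (hs : s < 1) :
    Summable fun k => ‖taylorCoeff f k‖ * ‖taylorCoeff g k‖ * s ^ k := by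
  have hs' : √s < 1 := (Real.sqrt_lt' one_pos).2 (by simpa using hs)
  have h1 := summable_norm_taylorCoeff hf (Real.sqrt_nonneg _) hs'
  have h2 := summable_norm_taylorCoeff hg (Real.sqrt_nonneg _) hs'
  -- Each factor is summable at radius `√s < 1`; the series in question is the diagonal of their
  -- product.
  have h := (Summable.mul_of_nonneg h1 h2 (fun _ => by positivity)
    (fun _ => by positivity)).comp_injective (i := fun k => (k, k)) (fun a b h => (Prod.ext_iff.1 h).1)
  refine h.congr fun k => ?_
  have : s ^ k = √s ^ k * √s ^ k := by rw [← mul_pow, Real.mul_self_sqrt hs0]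
  simp only [Function.comp_apply, this]
  ring

theorem differentiableOn_hadamard {f g : ℂ → ℂ} (hf : DifferentiableOn ℂ f disc)
    (hg : DifferentiableOn ℂ g disc) : DifferentiableOn ℂ (hadamard f g) disc := by
  intro z hz
  rw [mem_disc] at hz
  obtain ⟨s, hzs, hs⟩ := exists_between hz
  have hs0 : 0 ≤ s := (norm_nonneg z).trans hzs.le
  have hd : DifferentiableOn ℂ (hadamard f g) (Metric.ball 0 s) := by
    refine Complex.differentiableOn_tsum_of_summable_norm
      (summable_norm_taylorCoeff_mul hf hg hs0 hs) (fun k => by fun_prop)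
      Metric.isOpen_ball fun k w hw => ?_
    have hw' : ‖w‖ ≤ s := by simpa using (mem_ball_zero_iff.1 hw).le
    simp only [norm_mul, norm_pow]
    gcongr
  exact (hd.differentiableAt
    (Metric.isOpen_ball.mem_nhds (by simpa using hzs))).differentiableWithinAt

theorem summable_hadamard {f g : ℂ → ℂ} (hf : DifferentiableOn ℂ f disc)
    (hg : DifferentiableOn ℂ g disc) {z : ℂ} (hz : z ∈ disc) :
    Summable fun k => taylorCoeff f k * taylorCoeff g k * z ^ k := by
  refine .of_norm ?_
  simpa using summable_norm_taylorCoeff_mul hf hg (norm_nonneg z) (mem_disc.1 hz)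

theorem hadamard_add {K f g : ℂ → ℂ} (hK : DifferentiableOn ℂ K disc)
    (hf : DifferentiableOn ℂ f disc) (hg : DifferentiableOn ℂ g disc) {z : ℂ} (hz : z ∈ disc) :
    hadamard K (fun w => f w + g w) z = hadamard K f z + hadamard K g z := by
  simp only [hadamard, taylorCoeff_add hf hg]
  rw [← (summable_hadamard hK hf hz).tsum_add (summable_hadamard hK hg hz)]
  exact tsum_congr fun k => by ring

theorem hadamard_const_mul (K : ℂ → ℂ) {f : ℂ → ℂ} (hf : DifferentiableOn ℂ f disc) (c z : ℂ) :
    hadamard K (fun w => c * f w) z = c * hadamard K f z := by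
  simp only [hadamard, taylorCoeff_const_mul hf]
  rw [← tsum_mul_left]
  exact tsum_congr fun k => by ring

theorem hadamard_pow (K : ℂ → ℂ) (m : ℕ) (z : ℂ) :
    hadamard K (fun w => w ^ m) z = taylorCoeff K m * z ^ m := by
  rw [hadamard, tsum_eq_single m fun k hk => by simp [taylorCoeff_pow, hk]]
  simp [taylorCoeff_pow]

/-- The Hadamard product with a geometric series is a dilation. -/
theorem hadamard_pow_mul_geometric {K : ℂ → ℂ} (hK : DifferentiableOn ℂ K disc) {n : ℕ}
    (hK0 : ∀ k < n, taylorCoeff K k = 0) {r : ℝ} (hr0 : 0 < r) (hr : r < 1) {z : ℂ}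
    (hz : z ∈ disc) :
    hadamard K (fun w => w ^ n * (1 - r * w)⁻¹) z = K (r * z) / r ^ n := by
  have hrz : ∀ z ∈ disc, ‖(r : ℂ) * z‖ < 1 := fun z hz => by
    rw [norm_mul, Complex.norm_real, Real.norm_of_nonneg hr0.le]
    exact mul_lt_one_of_nonneg_of_lt_one_left hr0.le hr (mem_disc.1 hz).le
  have hcoeff (k : ℕ) : taylorCoeff (fun w => w ^ n * (1 - r * w)⁻¹) k =
      if k < n then 0 else (r : ℂ) ^ (k - n) := by
    refine taylorCoeff_eq_of_hasSum (a := fun k => if k < n then 0 else (r : ℂ) ^ (k - n)) ?_ k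
    filter_upwards [disc_mem_nhds] with z hz
    rw [← hasSum_nat_add_iff' n]
    rw [Finset.sum_eq_zero fun k hk => by simp [Finset.mem_range.1 hk], sub_zero]
    convert! ((hasSum_geometric_of_norm_lt_one (hrz z hz)).mul_left (z ^ n)) using 1
    funext k
    simp only [Nat.not_lt.2 (Nat.le_add_left n k), if_false, Nat.add_sub_cancel, pow_add, mul_pow]
    ring
  have hr0' : (r : ℂ) ≠ 0 := by exact_mod_cast hr0.ne'
  rw [hadamard, eq_div_iff (pow_ne_zero n hr0'),
    ← (hasSum_taylorCoeff hK (mem_disc.2 (hrz z hz))).tsum_eq, ← tsum_mul_right]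
  refine tsum_congr fun k => ?_
  rw [hcoeff]
  split_ifs with hk
  · simp [hK0 k hk]
  · rw [mul_pow, ← Nat.sub_add_cancel (not_lt.1 hk)]
    simp only [Nat.add_sub_cancel, pow_add]
    ring

/-! ### Necessity: test functions near `z^n`. -/

theorem hardyNorm_top_le_ofReal {f : ℂ → ℂ} {M : ℝ} (hM : 0 ≤ M) :
    hardyNorm ∞ f ≤ ENNReal.ofReal M ↔ ∀ z ∈ disc, ‖f z‖ ≤ M := by
  simp only [hardyNorm, if_true, iSup_le_iff]
  refine forall₂_congr fun z _ => ?_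
  rw [← ofReal_norm, ENNReal.ofReal_le_ofReal_iff hM]

theorem bestApprox_le_hardyNorm (n : ℕ) (q : ℝ≥0∞) (f : ℂ → ℂ) :
    bestApprox n q f ≤ hardyNorm q f := by
  refine (iInf₂_le 0 (Submodule.zero_mem _)).trans ?_
  simp

/-- The choice `P = 0` makes the operator a contraction; necessity needs nothing more. -/
theorem IsBAP.norm_hadamard_le {n : ℕ} {K f : ℂ → ℂ} (h : IsBAP n ∞ (hadamard K))
    (hf : DifferentiableOn ℂ f disc) {M : ℝ} (hM : 0 ≤ M) (hfM : ∀ z ∈ disc, ‖f z‖ ≤ M) :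
    ∀ z ∈ disc, ‖hadamard K f z‖ ≤ M := by
  have hle := (hardyNorm_top_le_ofReal hM).2 hfM
  rw [← hardyNorm_top_le_ofReal hM]
  exact (h.norm_le f ⟨hf, hle.trans_lt ENNReal.ofReal_lt_top⟩).trans
    ((bestApprox_le_hardyNorm n ∞ f).trans hle)

theorem norm_le_of_norm_le_on_circle {f : ℂ → ℂ} (hf : Differentiable ℂ f) {M : ℝ}
    (hM : ∀ z : ℂ, ‖z‖ = 1 → ‖f z‖ ≤ M) {z : ℂ} (hz : z ∈ disc) : ‖f z‖ ≤ M := by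
  refine Complex.norm_le_of_forall_mem_frontier_norm_le (U := Metric.ball 0 1)
    Metric.isBounded_ball hf.diffContOnCl (fun w hw => hM w ?_) (subset_closure hz)
  rw [frontier_ball _ one_ne_zero] at hw
  simpa using hw

/-- A contractive multiplier with a gap of length `n` below the index `n` has the same gap
above it. -/
theorem IsBAP.taylorCoeff_eq_zero {n : ℕ} {K : ℂ → ℂ} (h : IsBAP n ∞ (hadamard K))
    (hK : DifferentiableOn ℂ K disc) (hK0 : ∀ k < n, taylorCoeff K k = 0)
    (hK1 : taylorCoeff K n = 1) {j : ℕ} (hj : 1 ≤ j) (hjn : j ≤ n) :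
    taylorCoeff K (n + j) = 0 := by
  set c := taylorCoeff K (n + j) with hc
  -- On the unit circle `z^(n-j) = z^n conj(z)^j`, so `f = z^n (1 + i Im(w)/2)` with `w = conj(c)
  -- z^j`, of modulus at most `√(1+s)`. The operator kills `z^(n-j)` and multiplies `z^(n+j)` by
  -- `c`, leaving `z^n + s z^(n+j)`.
  set f : ℂ → ℂ := fun z => z ^ n + (star c / 4 * z ^ (n + j) + (-c / 4) * z ^ (n - j)) with hf
  have hfd : Differentiable ℂ f := by fun_prop
  set s : ℝ := ‖c‖ ^ 2 / 4 with hs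
  have hs0 : 0 ≤ s := by positivity
  have hbound : ∀ z ∈ disc, ‖f z‖ ≤ √(1 + s) := by
    refine fun z hz => norm_le_of_norm_le_on_circle hfd (fun z hz => ?_) hz
    apply Real.le_sqrt_of_sq_le
    have hzz : z * star z = 1 := by
      rw [Complex.star_def, Complex.mul_conj, Complex.normSq_eq_norm_sq, hz]; simp
    have hfz : f z = z ^ n * (1 + (star c * z ^ j - star (star c * z ^ j)) / 4) := by
      have : z ^ n * star z ^ j = z ^ (n - j) := by
        nth_rw 1 [← Nat.sub_add_cancel hjn]
        rw [pow_add, mul_assoc, ← mul_pow, hzz, one_pow, mul_one]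
      simp only [hf, star_mul', star_star, star_pow, pow_add, ← this]
      ring
    have hw : ‖star c * z ^ j‖ = ‖c‖ := by simp [hz]
    rw [hfz, norm_mul, norm_pow, hz, one_pow, one_mul]
    generalize star c * z ^ j = w at hw
    have : (1 + (w - star w) / 4 : ℂ) = ⟨1, w.im / 2⟩ := by
      apply Complex.ext <;> simp; ring
    rw [this, ← Complex.normSq_eq_norm_sq, Complex.normSq_mk]
    have him := Complex.abs_im_le_norm w
    have := sq_le_sq' (neg_le_of_abs_le him) (le_of_abs_le him)
    rw [hw] at this
    rw [hs]
    nlinarith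
  have hT := h.norm_hadamard_le hfd.differentiableOn (Real.sqrt_nonneg _) hbound
  have hval (x : ℝ) (hx : x ∈ Set.Ioo (0 : ℝ) 1) : x ^ n + s * x ^ (n + j) ≤ √(1 + s) := by
    have hxd : (x : ℂ) ∈ disc := by simpa [mem_disc, abs_of_pos hx.1] using hx.2
    have := hT x hxd
    rw [hf, hadamard_add hK (by fun_prop) (by fun_prop) hxd,
      hadamard_add hK (by fun_prop) (by fun_prop) hxd, hadamard_const_mul K (by fun_prop),
      hadamard_const_mul K (by fun_prop), hadamard_pow, hadamard_pow, hadamard_pow, hK1,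
      hK0 (n - j) (by omega), ← hc] at this
    have he : (1 * (x : ℂ) ^ n + (star c / 4 * (c * x ^ (n + j)) + -c / 4 * (0 * x ^ (n - j)))) =
        ((x ^ n + s * x ^ (n + j) : ℝ) : ℂ) := by
      have : star c * c = ((‖c‖ ^ 2 : ℝ) : ℂ) := by
        rw [mul_comm, Complex.star_def, Complex.mul_conj, Complex.normSq_eq_norm_sq]
      push_cast [hs] at this ⊢
      linear_combination (x : ℂ) ^ (n + j) / 4 * this
    rw [he, Complex.norm_real] at this
    exact (le_abs_self _).trans this
  -- Letting `x` tend to `1` from below; the inequality forces `s = 0`.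
  have hlim : 1 + s ≤ √(1 + s) := by
    have hcont : Filter.Tendsto (fun x : ℝ => x ^ n + s * x ^ (n + j)) (𝓝[<] 1)
        (𝓝 (1 ^ n + s * 1 ^ (n + j))) :=
      (by fun_prop : Continuous fun x : ℝ => x ^ n + s * x ^ (n + j)).continuousAt.tendsto.mono_left
        nhdsWithin_le_nhds
    have := le_of_tendsto hcont (Filter.mem_of_superset (Ioo_mem_nhdsLT one_pos) hval)
    simpa using this
  have hsq := Real.sq_sqrt (by linarith : 0 ≤ 1 + s)
  have : s = 0 := by nlinarith
  simpa [hs] using this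

theorem half_le_re_inv_one_sub {u : ℂ} (hu : ‖u‖ < 1) : 1 / 2 ≤ ((1 - u)⁻¹).re := by
  have h1 : Complex.normSq u < 1 := by
    rw [Complex.normSq_eq_norm_sq]; nlinarith [norm_nonneg u]
  have hne : 1 - u ≠ 0 := by
    rintro h
    rw [← sub_eq_zero.1 h] at hu
    simp at hu
  have hpos := Complex.normSq_pos.2 hne
  rw [Complex.inv_re, div_le_div_iff₀ two_pos hpos]
  simp only [Complex.normSq_apply, Complex.sub_re, Complex.sub_im, Complex.one_re,
    Complex.one_im] at *
  nlinarith

theorem norm_sq_one_sub_smul (ε : ℝ) (g : ℂ) :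
    ‖1 - ε * g‖ ^ 2 = 1 - 2 * ε * g.re + ε ^ 2 * ‖g‖ ^ 2 := by
  simp only [← Complex.normSq_eq_norm_sq, Complex.normSq_apply, Complex.sub_re, Complex.sub_im,
    Complex.one_re, Complex.one_im, Complex.re_ofReal_mul, Complex.im_ofReal_mul]
  ring

/-- The test function is `z^n (1 - ε g)` with `g = 2/(1 - rz) - 1`, of nonnegative real part. The
geometric series reproduces `K`, so the image at `w/r` is `(w/r)^n (1 - ε p)`; comparing terms of
first order in `ε` gives `Re p ≥ 0`. -/
theorem IsBAP.half_le_re {n : ℕ} {K : ℂ → ℂ} (h : IsBAP n ∞ (hadamard K))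
    (hK : DifferentiableOn ℂ K disc) (hK0 : ∀ k < n, taylorCoeff K k = 0)
    (hK1 : taylorCoeff K n = 1) {w : ℂ} (hw : w ∈ disc) (hw0 : w ≠ 0) :
    1 / 2 ≤ (K w / w ^ n).re := by
  rw [mem_disc] at hw
  have hwpos : 0 < ‖w‖ := norm_pos_iff.2 hw0
  set p : ℂ := 2 * (K w / w ^ n) - 1 with hp
  have hstep (ε : ℝ) (hε : 0 < ε) (r : ℝ) (hr : r ∈ Set.Ioo ‖w‖ 1) :
      (‖w‖ / r) ^ n * ‖1 - ε * p‖ ≤ √(1 + ε ^ 2 * (2 * (1 - r)⁻¹ + 1) ^ 2) := by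
    have hr0 : 0 < r := hwpos.trans hr.1
    have hr0' : (r : ℂ) ≠ 0 := by exact_mod_cast hr0.ne'
    have hnorm : ∀ z ∈ disc, ‖(r : ℂ) * z‖ < r := fun z hz => by
      rw [norm_mul, Complex.norm_real, Real.norm_of_nonneg hr0.le]
      exact mul_lt_of_lt_one_right hr0 (mem_disc.1 hz)
    have hne : ∀ z ∈ disc, 1 - (r : ℂ) * z ≠ 0 := fun z hz h0 => by
      have := (hnorm z hz).trans hr.2
      rw [← sub_eq_zero.1 h0] at this
      simp at this
    have hgd : DifferentiableOn ℂ (fun z : ℂ => z ^ n * (1 - r * z)⁻¹) disc :=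
      DifferentiableOn.mul (by fun_prop) (DifferentiableOn.inv (by fun_prop) hne)
    have hfd : DifferentiableOn ℂ (fun z : ℂ => (1 + ε : ℂ) * z ^ n +
        (-2 * ε : ℂ) * (z ^ n * (1 - r * z)⁻¹)) disc :=
      DifferentiableOn.add (by fun_prop) (hgd.const_mul _)
    have hxd : w / r ∈ disc := by
      rw [mem_disc, norm_div, Complex.norm_real, Real.norm_of_nonneg hr0.le, div_lt_one hr0]
      exact hr.1
    have hT := h.norm_hadamard_le hfd
      (Real.sqrt_nonneg (1 + ε ^ 2 * (2 * (1 - r)⁻¹ + 1) ^ 2)) (fun z hz => ?_) (w / r) hxd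
    · rw [hadamard_add hK (by fun_prop) (hgd.const_mul _) hxd, hadamard_const_mul K (by fun_prop),
        hadamard_const_mul K hgd, hadamard_pow, hadamard_pow_mul_geometric hK hK0 hr0 hr.2 hxd,
        hK1, mul_div_cancel₀ _ hr0'] at hT
      have he : (1 + ε : ℂ) * (1 * (w / r) ^ n) + -2 * ε * (K w / r ^ n) =
          (w / r) ^ n * (1 - ε * p) := by
        have hrn := pow_ne_zero n hr0'
        have hwn := pow_ne_zero n hw0
        rw [hp, div_pow]
        field_simp
        ring
      rw [he, norm_mul, norm_pow, norm_div, Complex.norm_real, Real.norm_of_nonneg hr0.le] at hT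
      exact hT
    · set g : ℂ := 2 * (1 - r * z)⁻¹ - 1 with hg
      have he : (1 + ε : ℂ) * z ^ n + (-2 * ε : ℂ) * (z ^ n * (1 - r * z)⁻¹) =
          z ^ n * (1 - ε * g) := by rw [hg]; ring
      rw [he, norm_mul, norm_pow]
      refine (mul_le_of_le_one_left (norm_nonneg _)
        (pow_le_one₀ (norm_nonneg _) (mem_disc.1 hz).le)).trans ?_
      apply Real.le_sqrt_of_sq_le
      rw [norm_sq_one_sub_smul]
      have hre : 0 ≤ g.re := by
        have := half_le_re_inv_one_sub ((hnorm z hz).trans hr.2)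
        rw [hg, Complex.sub_re, Complex.one_re, show (2 : ℂ) = ((2 : ℝ) : ℂ) by simp,
          Complex.re_ofReal_mul]
        linarith
      have hgn : ‖g‖ ≤ 2 * (1 - r)⁻¹ + 1 := by
        refine (norm_sub_le _ _).trans ?_
        rw [norm_mul, norm_inv, norm_one, Complex.norm_ofNat]
        have h1r : 0 < 1 - r := sub_pos.2 hr.2
        gcongr
        have := norm_sub_norm_le (1 : ℂ) (r * z)
        rw [norm_one] at this
        linarith [hnorm z hz]
      have : ε ^ 2 * ‖g‖ ^ 2 ≤ ε ^ 2 * (2 * (1 - r)⁻¹ + 1) ^ 2 := by gcongr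
      nlinarith [mul_nonneg hε.le hre]
  set G : ℝ := 2 * (1 - ‖w‖)⁻¹ + 1
  -- As `r` decreases to `‖w‖`, the point `w/r` approaches the unit circle and the factor
  -- `(‖w‖/r)^n` disappears, while the bound on `g` stays finite with limit `G`.
  have hlim (ε : ℝ) (hε : 0 < ε) : ‖1 - ε * p‖ ≤ √(1 + ε ^ 2 * G ^ 2) := by
    have h1 : Filter.Tendsto (fun r : ℝ => (‖w‖ / r) ^ n * ‖1 - ε * p‖) (𝓝[>] ‖w‖)
        (𝓝 ((‖w‖ / ‖w‖) ^ n * ‖1 - ε * p‖)) := by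
      have : ContinuousAt (fun r : ℝ => (‖w‖ / r) ^ n * ‖1 - ε * p‖) ‖w‖ := by
        fun_prop (disch := exact hwpos.ne')
      exact this.tendsto.mono_left nhdsWithin_le_nhds
    have h2 : Filter.Tendsto (fun r : ℝ => √(1 + ε ^ 2 * (2 * (1 - r)⁻¹ + 1) ^ 2)) (𝓝[>] ‖w‖)
        (𝓝 √(1 + ε ^ 2 * G ^ 2)) := by
      have : ContinuousAt (fun r : ℝ => √(1 + ε ^ 2 * (2 * (1 - r)⁻¹ + 1) ^ 2)) ‖w‖ := by
        fun_prop (disch := exact (sub_pos.2 hw).ne')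
      exact this.tendsto.mono_left nhdsWithin_le_nhds
    have := le_of_tendsto_of_tendsto h1 h2
      (Filter.mem_of_superset (Ioo_mem_nhdsGT hw) (hstep ε hε))
    rwa [div_self hwpos.ne', one_pow, one_mul] at this
  -- Square, drop `ε² ‖p‖²`, and divide by `ε`.
  have hquad (ε : ℝ) (hε : 0 < ε) : 0 ≤ 2 * p.re + ε * G ^ 2 := by
    have h1 := (Real.le_sqrt (norm_nonneg _) (by positivity)).1 (hlim ε hε)
    rw [norm_sq_one_sub_smul] at h1
    have h2 : 0 ≤ ε * (2 * p.re + ε * G ^ 2) := by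
      nlinarith [mul_nonneg (sq_nonneg ε) (sq_nonneg ‖p‖)]
    exact nonneg_of_mul_nonneg_right h2 hε
  have hre : 0 ≤ 2 * p.re := by
    have hcont : Filter.Tendsto (fun ε : ℝ => 2 * p.re + ε * G ^ 2) (𝓝[>] 0)
        (𝓝 (2 * p.re + 0 * G ^ 2)) :=
      (by fun_prop : Continuous fun ε : ℝ => 2 * p.re + ε * G ^ 2).continuousAt.tendsto.mono_left
        nhdsWithin_le_nhds
    have := ge_of_tendsto hcont (Filter.mem_of_superset self_mem_nhdsWithin hquad)
    simpa using this
  rw [hp, Complex.sub_re, Complex.one_re, show (2 : ℂ) = ((2 : ℝ) : ℂ) by simp,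
    Complex.re_ofReal_mul] at hre
  linarith

/-! ### Integration over circles and Fourier coefficients. -/

open MeasureTheory in
theorem setLIntegral_sub_of_periodic {G : ℝ → ℝ≥0∞} {T : ℝ} (hT : 0 < T)
    (hG : Function.Periodic G T) (t : ℝ) :
    ∫⁻ θ in Set.Ioc 0 T, G (θ - t) = ∫⁻ θ in Set.Ioc 0 T, G θ := by
  have : VAddInvariantMeasure (AddSubgroup.zmultiples T) ℝ volume :=
    ⟨fun c s _ => measure_preimage_add _ _ _⟩
  have h := (measurePreserving_sub_right volume t).setLIntegral_comp_preimage_emb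
    (MeasurableEquiv.subRight t).measurableEmbedding G (Set.Ioc (-t) (-t + T))
  have hpre : (fun θ : ℝ => θ - t) ⁻¹' Set.Ioc (-t) (-t + T) = Set.Ioc 0 T := by
    ext θ
    simp only [Set.mem_preimage, Set.mem_Ioc]
    constructor <;> rintro ⟨h1, h2⟩ <;> constructor <;> linarith
  rw [hpre] at h
  rw [h]
  have := IsAddFundamentalDomain.setLIntegral_eq (G := AddSubgroup.zmultiples T)
    (isAddFundamentalDomain_Ioc hT (-t)) (isAddFundamentalDomain_Ioc hT 0) G hG.map_vadd_zmultiples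
  rwa [zero_add] at this

/-- Termwise integration of a Taylor series along a curve inside the disc. -/
theorem hasSum_integral_taylorCoeff {f : ℂ → ℂ} (hf : DifferentiableOn ℂ f disc) {r : ℝ}
    (hr0 : 0 ≤ r) (hr : r < 1) {γ v : ℝ → ℂ} (hγ : Continuous γ) (hγr : ∀ t, ‖γ t‖ ≤ r)
    (hv : Continuous v) (a b : ℝ) :
    HasSum (fun k => taylorCoeff f k * ∫ t in a..b, γ t ^ k * v t)
      (∫ t in a..b, f (γ t) * v t) := by
  have hs := summable_norm_taylorCoeff hf hr0 hr
  have := intervalIntegral.hasSum_integral_of_dominated_convergence (a := a) (b := b)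
    (μ := MeasureTheory.volume) (F := fun k t => taylorCoeff f k * (γ t ^ k * v t))
    (f := fun t => f (γ t) * v t) (fun k t => ‖taylorCoeff f k‖ * r ^ k * ‖v t‖)
    (fun k => (by fun_prop : Continuous _).aestronglyMeasurable)
    (fun k => .of_forall fun t _ => ?_) (.of_forall fun t _ => hs.mul_right _) ?_
    (.of_forall fun t _ => ?_)
  · simpa only [intervalIntegral.integral_const_mul] using this
  · rw [norm_mul, norm_mul, norm_pow, mul_assoc]
    gcongr
    exact hγr t
  · simp only [tsum_mul_right]
    exact (by fun_prop : Continuous _).intervalIntegrable _ _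
  · simpa only [mul_assoc] using
      (hasSum_taylorCoeff hf (mem_disc.2 ((hγr t).trans_lt hr))).mul_right (v t)

/-- The character `t ↦ e ^ (i m t)`. -/
noncomputable def expI (m : ℤ) (t : ℝ) : ℂ := Complex.exp (m * t * Complex.I)

@[fun_prop]
theorem continuous_expI (m : ℤ) : Continuous (expI m) := by
  unfold expI
  fun_prop

theorem expI_mul (l m : ℤ) (t : ℝ) : expI l t * expI m t = expI (l + m) t := by
  simp only [expI, ← Complex.exp_add]
  congr 1
  push_cast
  ring

theorem star_expI (m : ℤ) (t : ℝ) : star (expI m t) = expI (-m) t := by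
  rw [expI, Complex.star_def, ← Complex.exp_conj]
  simp [expI]

theorem norm_expI (m : ℤ) (t : ℝ) : ‖expI m t‖ = 1 := by
  rw [expI]
  exact_mod_cast Complex.norm_exp_ofReal_mul_I (m * t)

theorem circleMap_pow_eq (r t : ℝ) (k : ℕ) : circleMap 0 r t ^ k = (r : ℂ) ^ k * expI k t := by
  rw [circleMap_zero, mul_pow, ← Complex.exp_nat_mul, expI]
  congr 2
  push_cast
  ring

theorem integral_expI (m : ℤ) :
    ∫ t in (0 : ℝ)..2 * Real.pi, expI m t = if m = 0 then 2 * (Real.pi : ℂ) else 0 := by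
  split_ifs with hm
  · simp [hm, expI]
  · have hm' : (m : ℂ) * Complex.I ≠ 0 := by simp [hm]
    have : expI m = fun t : ℝ => Complex.exp (m * Complex.I * t) := by
      funext t
      rw [expI]
      ring_nf
    rw [this, integral_exp_mul_complex hm', div_eq_zero_iff]
    left
    rw [show (m : ℂ) * Complex.I * ((2 * Real.pi : ℝ) : ℂ) = m * (2 * Real.pi * Complex.I) by
      push_cast; ring, Complex.exp_int_mul_two_pi_mul_I]
    simp

theorem norm_circleMap_le {r : ℝ} (hr0 : 0 ≤ r) (t : ℝ) : ‖circleMap 0 r t‖ ≤ r := by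
  simp [abs_of_nonneg hr0]

theorem continuous_comp_circleMap {f : ℂ → ℂ} (hf : DifferentiableOn ℂ f disc) {r : ℝ}
    (hr0 : 0 ≤ r) (hr : r < 1) : Continuous fun t => f (circleMap 0 r t) :=
  hf.continuousOn.comp_continuous (continuous_circleMap 0 r) fun t =>
    mem_disc.2 ((norm_circleMap_le hr0 t).trans_lt hr)

/-- The Fourier coefficients of a holomorphic function on a circle. -/
theorem hasSum_integral_mul_expI {f : ℂ → ℂ} (hf : DifferentiableOn ℂ f disc) {r : ℝ}
    (hr0 : 0 ≤ r) (hr : r < 1) (m : ℤ) :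
    HasSum (fun k : ℕ => if (k : ℤ) = m then taylorCoeff f k * r ^ k * (2 * Real.pi) else 0)
      (∫ t in (0 : ℝ)..2 * Real.pi, f (circleMap 0 r t) * expI (-m) t) := by
  have h := hasSum_integral_taylorCoeff hf hr0 hr (continuous_circleMap 0 r)
    (norm_circleMap_le hr0) (continuous_expI (-m)) 0 (2 * Real.pi)
  have he : (fun k : ℕ => if (k : ℤ) = m then taylorCoeff f k * r ^ k * (2 * (Real.pi : ℂ)) else 0) =
      fun k => taylorCoeff f k * ∫ t in (0 : ℝ)..2 * Real.pi, circleMap 0 r t ^ k * expI (-m) t := by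
    funext k
    simp only [circleMap_pow_eq, mul_assoc, expI_mul, intervalIntegral.integral_const_mul,
      integral_expI, ← sub_eq_add_neg, sub_eq_zero]
    split_ifs <;> simp
  rw [he]
  exact h

/-! ### Sufficiency: the convolution kernel. -/

/-- The convolution kernel on the circle of radius `r`. Up to the factor `r ^ n e ^ (i n t)` it is
`2 Re (K z / z ^ n) - 1` at `z = r e ^ (i t)`. -/
noncomputable def circleKernel (n : ℕ) (K : ℂ → ℂ) (r t : ℝ) : ℂ :=
  K (circleMap 0 r t) + expI (2 * n) t * star (K (circleMap 0 r t)) - (r : ℂ) ^ n * expI n t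

section Kernel

variable {n : ℕ} {K : ℂ → ℂ} {r : ℝ}

theorem continuous_circleKernel (hK : DifferentiableOn ℂ K disc) (hr0 : 0 ≤ r) (hr : r < 1) :
    Continuous (circleKernel n K r) := by
  have := continuous_comp_circleMap hK hr0 hr
  exact (this.add ((continuous_expI _).mul this.star)).sub
    (continuous_const.mul (continuous_expI _))

/-- At a frequency `k ≥ 0` the reflected term sees only the coefficient of index `2n - k ≤ 2n`. By
the gap it is nonzero only for `k = n`, where the subtracted monomial cancels it. -/
theorem integral_circleKernel_mul_expI (hK : DifferentiableOn ℂ K disc)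
    (hK0 : ∀ k ≤ 2 * n, k ≠ n → taylorCoeff K k = 0) (hK1 : taylorCoeff K n = 1)
    (hr0 : 0 ≤ r) (hr : r < 1) (k : ℕ) :
    ∫ t in (0 : ℝ)..2 * Real.pi, circleKernel n K r t * expI (-k) t =
      taylorCoeff K k * r ^ k * (2 * Real.pi) := by
  have hc := continuous_comp_circleMap hK hr0 hr
  have h1 : ∫ t in (0 : ℝ)..2 * Real.pi, K (circleMap 0 r t) * expI (-k) t =
      taylorCoeff K k * r ^ k * (2 * Real.pi) := by
    refine (hasSum_integral_mul_expI hK hr0 hr k).unique ?_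
    convert! hasSum_single (f := fun l : ℕ => if (l : ℤ) = k then
      taylorCoeff K l * (r : ℂ) ^ l * (2 * Real.pi) else 0) k ?_ using 1
    · simp
    · intro l hl
      simp [hl]
  have h2 : ∫ t in (0 : ℝ)..2 * Real.pi, star (K (circleMap 0 r t) * expI (-(2 * n - k)) t) =
      if k = n then (r : ℂ) ^ n * (2 * Real.pi) else 0 := by
    have : ∫ t in (0 : ℝ)..2 * Real.pi, K (circleMap 0 r t) * expI (-(2 * n - k)) t =
        if k = n then (r : ℂ) ^ n * (2 * Real.pi) else 0 := by
      refine (hasSum_integral_mul_expI hK hr0 hr (2 * n - k)).unique ?_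
      convert! hasSum_single (f := fun l : ℕ => if (l : ℤ) = 2 * n - k then
        taylorCoeff K l * (r : ℂ) ^ l * (2 * Real.pi) else 0) n ?_ using 1
      · have : ((n : ℤ) = 2 * n - k) ↔ k = n := by omega
        simp [this, hK1]
      · intro l hl
        split_ifs with h
        · rw [hK0 l (by omega) hl]; simp
        · rfl
    have h3 := intervalIntegral.intervalIntegral_conj (a := 0) (b := 2 * Real.pi)
      (f := fun t => K (circleMap 0 r t) * expI (-(2 * n - k)) t) (μ := MeasureTheory.volume)
    rw [this] at h3
    simp only [Complex.star_def]
    rw [h3]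
    split_ifs <;> simp [Complex.conj_ofNat]
  have h3 : ∫ t in (0 : ℝ)..2 * Real.pi, (r : ℂ) ^ n * expI (n - k) t =
      if k = n then (r : ℂ) ^ n * (2 * Real.pi) else 0 := by
    have : ((n : ℤ) - k = 0) ↔ k = n := by omega
    rw [intervalIntegral.integral_const_mul, integral_expI]
    simp [this]
  have he (t : ℝ) : circleKernel n K r t * expI (-k) t = K (circleMap 0 r t) * expI (-k) t +
      star (K (circleMap 0 r t) * expI (-(2 * n - k)) t) - (r : ℂ) ^ n * expI (n - k) t := by
    rw [star_mul', star_expI, neg_neg, sub_eq_add_neg (2 * n : ℤ), sub_eq_add_neg (n : ℤ),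
      ← expI_mul, ← expI_mul, circleKernel]
    ring
  simp only [he]
  have hc' : Continuous fun t => star (K (circleMap 0 r t) * expI (-(2 * n - k)) t) :=
    (hc.mul (continuous_expI _)).star
  have hc1 := hc.mul (continuous_expI (-k))
  rw [intervalIntegral.integral_sub, intervalIntegral.integral_add, h1, h2, h3]
  · ring
  · exact hc1.intervalIntegrable _ _
  · exact hc'.intervalIntegrable _ _
  · exact (hc1.add hc').intervalIntegrable _ _
  · exact (continuous_const.mul (continuous_expI _)).intervalIntegrable _ _

/-- After removal of the phase `e^(int)` the kernel is `r^n (2 Re (K/z^n) - 1)`, real and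
nonnegative. -/
theorem circleKernel_mul_expI_eq_norm (hKre : ∀ z ∈ disc, z ≠ 0 → 1 / 2 ≤ (K z / z ^ n).re)
    (hr0 : 0 < r) (hr : r < 1) (t : ℝ) :
    circleKernel n K r t * expI (-n) t = (‖circleKernel n K r t‖ : ℂ) := by
  set z := circleMap 0 r t with hz
  have hzn : ‖z‖ = r := by simp [hz, abs_of_pos hr0]
  have hz0 : z ≠ 0 := norm_pos_iff.1 (hzn ▸ hr0)
  have hre := hKre z (mem_disc.2 (hzn.trans_lt hr)) hz0
  set u : ℝ := r ^ n * (2 * (K z / z ^ n).re - 1) with hu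
  have hu0 : 0 ≤ u := mul_nonneg (by positivity) (by linarith)
  have hzp : z ^ n = (r : ℂ) ^ n * expI n t := circleMap_pow_eq r t n
  have hrn : (r : ℂ) ^ n ≠ 0 := pow_ne_zero n (by exact_mod_cast hr0.ne')
  have hinv : expI n t * expI (-n) t = 1 := by rw [expI_mul]; simp [expI]
  have hKe : K z * expI (-n) t = (r : ℂ) ^ n * (K z / z ^ n) := by
    rw [hzp]
    have hne : expI n t ≠ 0 := left_ne_zero_of_mul_eq_one hinv
    field_simp
    linear_combination K z * hinv
  have hKs : expI n t * star (K z) = (r : ℂ) ^ n * star (K z / z ^ n) := by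
    have := congrArg star hKe
    rw [star_mul', star_mul', star_expI, neg_neg, star_pow] at this
    rw [mul_comm, this]
    simp
  have h2 : expI (2 * n) t * expI (-n) t = expI n t := by
    rw [expI_mul]
    congr 1
    ring
  have heq : circleKernel n K r t * expI (-n) t = (u : ℂ) := by
    have hadd : K z / z ^ n + star (K z / z ^ n) = ((2 * (K z / z ^ n).re : ℝ) : ℂ) := by
      rw [Complex.star_def, Complex.add_conj]
    have : circleKernel n K r t * expI (-n) t =
        K z * expI (-n) t + (expI (2 * n) t * expI (-n) t) * star (K z) -
          (r : ℂ) ^ n * (expI n t * expI (-n) t) := by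
      rw [circleKernel, ← hz]
      ring
    rw [this, h2, hKe, hKs, hinv, hu]
    push_cast at hadd ⊢
    linear_combination (r : ℂ) ^ n * hadd
  have hnorm : ‖circleKernel n K r t‖ = u := by
    have := congrArg norm heq
    rwa [norm_mul, norm_expI, mul_one, Complex.norm_real, Real.norm_of_nonneg hu0] at this
  rw [heq, hnorm]

/-- By positivity the integral of the modulus is the Fourier integral at frequency `n`, known from
`taylorCoeff K n = 1`. -/
theorem lintegral_enorm_circleKernel (hK : DifferentiableOn ℂ K disc)
    (hK0 : ∀ k ≤ 2 * n, k ≠ n → taylorCoeff K k = 0) (hK1 : taylorCoeff K n = 1)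
    (hKre : ∀ z ∈ disc, z ≠ 0 → 1 / 2 ≤ (K z / z ^ n).re) (hr0 : 0 < r) (hr : r < 1) :
    ∫⁻ t in Set.Ioc (0 : ℝ) (2 * Real.pi), ‖circleKernel n K r t‖ₑ =
      ENNReal.ofReal (r ^ n * (2 * Real.pi)) := by
  have hc := continuous_circleKernel (n := n) hK hr0.le hr
  have h := integral_circleKernel_mul_expI hK hK0 hK1 hr0.le hr n
  simp only [circleKernel_mul_expI_eq_norm hKre hr0 hr, intervalIntegral.integral_ofReal, hK1,
    one_mul] at h
  have h' : ∫ t in (0 : ℝ)..2 * Real.pi, ‖circleKernel n K r t‖ = r ^ n * (2 * Real.pi) := by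
    exact_mod_cast h
  rw [intervalIntegral.integral_of_le Real.two_pi_pos.le] at h'
  rw [← h', MeasureTheory.ofReal_integral_norm_eq_lintegral_enorm]
  exact (intervalIntegrable_iff_integrableOn_Ioc_of_le Real.two_pi_pos.le).1
    (hc.intervalIntegrable _ _)

theorem integral_mul_circleKernel (hK : DifferentiableOn ℂ K disc)
    (hK0 : ∀ k ≤ 2 * n, k ≠ n → taylorCoeff K k = 0) (hK1 : taylorCoeff K n = 1)
    (hr0 : 0 ≤ r) (hr : r < 1) {f : ℂ → ℂ} (hf : DifferentiableOn ℂ f disc) {ρ : ℝ}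
    (hρ0 : 0 ≤ ρ) (hρ : ρ < 1) (θ : ℝ) :
    ∫ t in (0 : ℝ)..2 * Real.pi, f (circleMap 0 ρ (θ - t)) * circleKernel n K r t =
      hadamard K f (circleMap 0 (r * ρ) θ) * (2 * Real.pi) := by
  have hc := continuous_circleKernel (n := n) hK hr0 hr
  have h := hasSum_integral_taylorCoeff hf hρ0 hρ
    ((continuous_circleMap 0 ρ).comp (continuous_sub_left θ))
    (fun t => norm_circleMap_le hρ0 _) hc 0 (2 * Real.pi)
  have hz : circleMap 0 (r * ρ) θ ∈ disc := by
    refine mem_disc.2 ((norm_circleMap_le (mul_nonneg hr0 hρ0) θ).trans_lt ?_)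
    exact mul_lt_one_of_nonneg_of_lt_one_left hr0 hr hρ.le
  refine h.unique ?_
  convert! (summable_hadamard hK hf hz).hasSum.mul_right (2 * (Real.pi : ℂ)) using 1
  funext k
  have he (t : ℝ) : circleMap 0 ρ (θ - t) ^ k * circleKernel n K r t =
      (ρ : ℂ) ^ k * expI k θ * (circleKernel n K r t * expI (-k) t) := by
    have : expI k (θ - t) = expI k θ * expI (-k) t := by
      simp only [expI, ← Complex.exp_add]
      congr 1
      push_cast
      ring
    rw [circleMap_pow_eq, this]
    ring
  simp only [Function.comp_apply, he, intervalIntegral.integral_const_mul,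
    integral_circleKernel_mul_expI hK hK0 hK1 hr0 hr]
  rw [circleMap_pow_eq]
  push_cast
  rw [mul_pow]
  ring

end Kernel

/-! ### Sufficiency: contractivity on the Hardy spaces. -/

open MeasureTheory in
/-- Jensen's inequality for powers with respect to a weight of total mass at most one. -/
theorem rpow_lintegral_mul_le {α : Type*} [MeasurableSpace α] {μ : Measure α} {g w : α → ℝ≥0∞}
    (hg : Measurable g) (hw : Measurable w) (hw1 : ∫⁻ t, w t ∂μ ≤ 1) {p : ℝ} (hp : 1 ≤ p) :
    (∫⁻ t, g t * w t ∂μ) ^ p ≤ ∫⁻ t, g t ^ p * w t ∂μ := by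
  -- Monotonicity of `L^p` norms for the measure of density `w`; the factor from its total mass is
  -- at most one.
  have h := eLpNorm_le_eLpNorm_mul_rpow_measure_univ (μ := μ.withDensity w) (f := g)
    (p := 1) (q := ENNReal.ofReal p) (by simpa using hp) hg.aestronglyMeasurable
  have hp0 : 0 < p := one_pos.trans_le hp
  rw [eLpNorm_one_eq_lintegral_enorm, eLpNorm_eq_lintegral_rpow_enorm_toReal (by simpa using hp0)
    ENNReal.ofReal_ne_top, ENNReal.toReal_ofReal hp0.le,
    lintegral_withDensity_eq_lintegral_mul _ hw (by simpa using hg),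
    lintegral_withDensity_eq_lintegral_mul _ hw (by simpa using hg.pow_const p)] at h
  simp only [Pi.mul_apply, enorm_eq_self, mul_comm (w _)] at h
  have hone : (μ.withDensity w) Set.univ ^ (1 / (1 : ℝ≥0∞).toReal - 1 / p) ≤ 1 := by
    refine ENNReal.rpow_le_one ?_ ?_
    · simpa [withDensity_apply] using hw1
    · have : 1 / p ≤ 1 := by rw [div_le_one hp0]; exact hp
      simpa using this
  have h' := h.trans (mul_le_of_le_one_right' hone)
  calc _ ≤ ((∫⁻ t, g t ^ p * w t ∂μ) ^ (1 / p)) ^ p := ENNReal.rpow_le_rpow h' hp0.le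
    _ = _ := by rw [← ENNReal.rpow_mul, one_div_mul_cancel hp0.ne', ENNReal.rpow_one]

/-- The hypotheses on the Taylor coefficients and on the real part make the multiplier an average
of rotations with respect to a weight of mass at most one. -/
theorem exists_weight {n : ℕ} {K : ℂ → ℂ} (hK : DifferentiableOn ℂ K disc)
    (hK0 : ∀ k ≤ 2 * n, k ≠ n → taylorCoeff K k = 0) (hK1 : taylorCoeff K n = 1)
    (hKre : ∀ z ∈ disc, z ≠ 0 → 1 / 2 ≤ (K z / z ^ n).re) {r : ℝ} (hr0 : 0 < r) (hr : r < 1) :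
    ∃ w : ℝ → ℝ≥0∞, Measurable w ∧ ∫⁻ t in Set.Ioc (0 : ℝ) (2 * Real.pi), w t ≤ 1 ∧
      ∀ f, DifferentiableOn ℂ f disc → ∀ ρ : ℝ, 0 ≤ ρ → ρ < 1 → ∀ θ : ℝ,
        ‖hadamard K f (circleMap 0 (r * ρ) θ)‖ₑ ≤
          ∫⁻ t in Set.Ioc (0 : ℝ) (2 * Real.pi), ‖f (circleMap 0 ρ (θ - t))‖ₑ * w t := by
  have hc := continuous_circleKernel (n := n) hK hr0.le hr
  have hpi : ENNReal.ofReal (2 * Real.pi) ≠ 0 := by simpa using Real.pi_pos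
  refine ⟨fun t => ‖circleKernel n K r t‖ₑ / ENNReal.ofReal (2 * Real.pi),
    hc.measurable.enorm.div_const _, ?_, fun f hf ρ hρ0 hρ θ => ?_⟩
  · simp only [div_eq_mul_inv]
    rw [MeasureTheory.lintegral_mul_const _ hc.measurable.enorm,
      lintegral_enorm_circleKernel hK hK0 hK1 hKre hr0 hr, ENNReal.ofReal_mul (by positivity),
      mul_assoc, ENNReal.mul_inv_cancel hpi ENNReal.ofReal_ne_top, mul_one]
    exact ENNReal.ofReal_le_one.2 (pow_le_one₀ hr0.le hr.le)
  · have hcf : Continuous fun t => f (circleMap 0 ρ (θ - t)) :=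
      (continuous_comp_circleMap hf hρ0 hρ).comp (continuous_sub_left θ)
    have hcm : Continuous fun t => f (circleMap 0 ρ (θ - t)) * circleKernel n K r t := hcf.mul hc
    have h := integral_mul_circleKernel hK hK0 hK1 hr0.le hr hf hρ0 hρ θ
    rw [intervalIntegral.integral_of_le Real.two_pi_pos.le] at h
    have h2 := congrArg enorm h
    have hpie : ‖(2 * Real.pi : ℂ)‖ₑ = ENNReal.ofReal (2 * Real.pi) := by
      rw [← ofReal_norm]
      congr 1
      simp [abs_of_pos Real.pi_pos]
    rw [enorm_mul, hpie] at h2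
    simp only [div_eq_mul_inv, ← mul_assoc, ← enorm_mul]
    rw [MeasureTheory.lintegral_mul_const _ hcm.measurable.enorm,
      ← div_eq_mul_inv, ENNReal.le_div_iff_mul_le (.inl hpi) (.inl ENNReal.ofReal_ne_top), ← h2]
    exact MeasureTheory.enorm_integral_le_lintegral_enorm _

/-- For finite `q`, Jensen, Tonelli and rotation invariance bound the mean at radius `rρ` by the
mean of `f` at radius `ρ`; for `q = ∞` the supremum comes out of the integral. -/
theorem hardyNorm_hadamard_le {n : ℕ} {K : ℂ → ℂ} (hK : DifferentiableOn ℂ K disc)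
    (hK0 : ∀ k ≤ 2 * n, k ≠ n → taylorCoeff K k = 0) (hK1 : taylorCoeff K n = 1)
    (hKre : ∀ z ∈ disc, z ≠ 0 → 1 / 2 ≤ (K z / z ^ n).re) {q : ℝ≥0∞} (hq : 1 ≤ q) {f : ℂ → ℂ}
    (hf : DifferentiableOn ℂ f disc) : hardyNorm q (hadamard K f) ≤ hardyNorm q f := by
  -- Kernel and function each need a radius below `1`, with product `s`; `r` is the midpoint of `s`
  -- and `1`.
  have hsplit (s : ℝ) (hs0 : 0 ≤ s) (hs1 : s < 1) : ∃ r ρ : ℝ, 0 < r ∧ r < 1 ∧ 0 ≤ ρ ∧ ρ < 1 ∧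
      r * ρ = s := by
    refine ⟨(1 + s) / 2, s / ((1 + s) / 2), by linarith, by linarith, by positivity, ?_, ?_⟩
    · rw [div_lt_one (by linarith)]; linarith
    · rw [mul_div_cancel₀]; linarith
  unfold hardyNorm
  split_ifs with htop
  · refine iSup₂_le fun z hz => ?_
    obtain ⟨r, ρ, hr0, hr, hρ0, hρ, hs⟩ := hsplit ‖z‖ (norm_nonneg z) (mem_disc.1 hz)
    obtain ⟨w, -, hw1, hle⟩ := exists_weight hK hK0 hK1 hKre hr0 hr
    have h := hle f hf ρ hρ0 hρ z.arg
    rw [hs, circleMap_zero, Complex.norm_mul_exp_arg_mul_I] at h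
    set S := ⨆ z ∈ disc, ‖f z‖ₑ
    have hS : ∀ t, ‖f (circleMap 0 ρ (z.arg - t))‖ₑ ≤ S := fun t =>
      le_iSup₂ (f := fun z (_ : z ∈ disc) => ‖f z‖ₑ) _
        (mem_disc.2 ((norm_circleMap_le hρ0 _).trans_lt hρ))
    refine h.trans ((MeasureTheory.lintegral_mono fun t => mul_le_mul_left (hS t) (w t)).trans ?_)
    rcases eq_or_ne S ∞ with hS' | hS'
    · rw [hS']; exact le_top
    · rw [MeasureTheory.lintegral_const_mul' _ _ hS']
      exact mul_le_of_le_one_right' hw1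
  · have hq1 : 1 ≤ q.toReal := by
      simpa using ENNReal.toReal_mono htop hq
    have hq0 : 0 < q.toReal := one_pos.trans_le hq1
    refine iSup₂_le fun s hs => ?_
    obtain ⟨r, ρ, hr0, hr, hρ0, hρ, hsr⟩ := hsplit s hs.1.le hs.2
    obtain ⟨w, hwm, hw1, hle⟩ := exists_weight hK hK0 hK1 hKre hr0 hr
    have hρ0' : 0 < ρ := by
      refine hρ0.lt_of_ne fun h0 => hs.1.ne ?_
      rw [← hsr, ← h0, mul_zero]
    refine le_iSup₂_of_le ρ ⟨hρ0', hρ⟩ ?_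
    refine ENNReal.rpow_le_rpow (ENNReal.div_le_div_right ?_ _) (by positivity)
    have hcf := continuous_comp_circleMap hf hρ0 hρ
    have hmeas : Measurable fun θ : ℝ => ‖f (circleMap 0 ρ θ)‖ₑ ^ q.toReal :=
      hcf.measurable.enorm.pow_const _
    calc ∫⁻ θ in Set.Ioc (0 : ℝ) (2 * Real.pi), ‖hadamard K f (circleMap 0 s θ)‖ₑ ^ q.toReal
        ≤ ∫⁻ θ in Set.Ioc (0 : ℝ) (2 * Real.pi), ∫⁻ t in Set.Ioc (0 : ℝ) (2 * Real.pi),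
            ‖f (circleMap 0 ρ (θ - t))‖ₑ ^ q.toReal * w t := by
          refine MeasureTheory.lintegral_mono fun θ => ?_
          rw [← hsr]
          refine (ENNReal.rpow_le_rpow (hle f hf ρ hρ0 hρ θ) hq0.le).trans ?_
          exact rpow_lintegral_mul_le
            (hcf.comp (continuous_sub_left θ)).measurable.enorm hwm hw1 hq1
      _ = ∫⁻ t in Set.Ioc (0 : ℝ) (2 * Real.pi), ∫⁻ θ in Set.Ioc (0 : ℝ) (2 * Real.pi),
            ‖f (circleMap 0 ρ (θ - t))‖ₑ ^ q.toReal * w t := by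
          refine MeasureTheory.lintegral_lintegral_swap (Measurable.aemeasurable ?_)
          exact (hmeas.comp (measurable_fst.sub measurable_snd)).mul (hwm.comp measurable_snd)
      _ = ∫⁻ t in Set.Ioc (0 : ℝ) (2 * Real.pi),
            (∫⁻ θ in Set.Ioc (0 : ℝ) (2 * Real.pi), ‖f (circleMap 0 ρ θ)‖ₑ ^ q.toReal) * w t := by
          refine MeasureTheory.lintegral_congr fun t => ?_
          have hmeas' : Measurable fun θ : ℝ => ‖f (circleMap 0 ρ (θ - t))‖ₑ ^ q.toReal :=
            hmeas.comp (measurable_sub_const t)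
          rw [MeasureTheory.lintegral_mul_const _ hmeas']
          congr 1
          refine setLIntegral_sub_of_periodic (G := fun θ => ‖f (circleMap 0 ρ θ)‖ₑ ^ q.toReal)
            Real.two_pi_pos (fun θ => ?_) t
          simp only [periodic_circleMap 0 ρ θ]
      _ = (∫⁻ θ in Set.Ioc (0 : ℝ) (2 * Real.pi), ‖f (circleMap 0 ρ θ)‖ₑ ^ q.toReal) *
            ∫⁻ t in Set.Ioc (0 : ℝ) (2 * Real.pi), w t :=
          MeasureTheory.lintegral_const_mul _ hwm
      _ ≤ _ := mul_le_of_le_one_right' hw1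

/-- Subtracting a polynomial of degree below `n` does not change the image, so contractivity applies
to `f - P`. -/
theorem hardyNorm_hadamard_le_bestApprox {n : ℕ} {K : ℂ → ℂ} (hK : DifferentiableOn ℂ K disc)
    (hK0 : ∀ k ≤ 2 * n, k ≠ n → taylorCoeff K k = 0) (hK1 : taylorCoeff K n = 1)
    (hKre : ∀ z ∈ disc, z ≠ 0 → 1 / 2 ≤ (K z / z ^ n).re) {q : ℝ≥0∞} (hq : 1 ≤ q) {f : ℂ → ℂ}
    (hf : DifferentiableOn ℂ f disc) : hardyNorm q (hadamard K f) ≤ bestApprox n q f := by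
  refine le_iInf₂ fun P hP => ?_
  have hPd : DifferentiableOn ℂ (fun z => P.eval z) disc := P.differentiable.differentiableOn
  have he : hadamard K f = hadamard K (fun z => f z - P.eval z) := by
    funext z
    refine tsum_congr fun k => ?_
    rw [taylorCoeff_sub hf hPd, taylorCoeff_polynomial]
    rcases lt_or_ge k n with hk | hk
    · rw [hK0 k (by omega) hk.ne]; simp
    · rw [Polynomial.coeff_eq_zero_of_degree_lt
        ((Polynomial.mem_degreeLT.1 hP).trans_le (by exact_mod_cast hk)), sub_zero]
  rw [he]
  exact hardyNorm_hadamard_le hK hK0 hK1 hKre hq (hf.sub hPd)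

theorem isBAP_hadamard {n : ℕ} {K : ℂ → ℂ} (hK : DifferentiableOn ℂ K disc)
    (hK0 : ∀ k ≤ 2 * n, k ≠ n → taylorCoeff K k = 0) (hK1 : taylorCoeff K n = 1)
    (hKre : ∀ z ∈ disc, z ≠ 0 → 1 / 2 ≤ (K z / z ^ n).re) {q : ℝ≥0∞} (hq : 1 ≤ q) :
    IsBAP n q (hadamard K) where
  mapsTo f hf := ⟨differentiableOn_hadamard hK hf.1,
    (hardyNorm_hadamard_le hK hK0 hK1 hKre hq hf.1).trans_lt hf.2⟩
  map_add _ _ hf hg _ hz := hadamard_add hK hf.1 hg.1 hz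
  map_smul c _ hf z _ := hadamard_const_mul K hf.1 c z
  bounded := ⟨1, fun f hf => by
    simpa using hardyNorm_hadamard_le hK hK0 hK1 hKre hq hf.1⟩
  map_monomial z _ := by simp [hadamard_pow, hK1]
  norm_le f hf := hardyNorm_hadamard_le_bestApprox hK hK0 hK1 hKre hq hf.1

end HadamardBAP

/-! ### The characterization. -/

theorem theorem1 (n : ℕ) (K : ℂ → ℂ) (hK : DifferentiableOn ℂ K HadamardBAP.disc)
    (hKn : Asymptotics.IsBigO (𝓝 0) (fun z => K z - z ^ n) (fun z => z ^ (n + 1))) :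
    (HadamardBAP.IsBAP n ∞ (HadamardBAP.hadamard K) ↔ HadamardBAP.KernelCondition n K) ∧
      (HadamardBAP.KernelCondition n K →
        ∀ q : ℝ≥0∞, 1 ≤ q → HadamardBAP.IsBAP n q (HadamardBAP.hadamard K)) := by
  open HadamardBAP in
  have hd : DifferentiableOn ℂ (fun z => K z - z ^ n) disc := hK.sub (by fun_prop)
  have hcoeff (k : ℕ) : taylorCoeff (fun z => K z - z ^ n) k =
      taylorCoeff K k - if k = n then 1 else 0 := by
    rw [taylorCoeff_sub hK (by fun_prop), taylorCoeff_pow]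
  have h0 := (isBigO_pow_iff_taylorCoeff hd (n + 1)).1 hKn
  have hK1 : taylorCoeff K n = 1 := by
    have := h0 n (by omega)
    rw [hcoeff, if_pos rfl] at this
    exact sub_eq_zero.1 this
  have hKlow : ∀ k < n, taylorCoeff K k = 0 := fun k hk => by
    have := h0 k (by omega)
    rwa [hcoeff, if_neg hk.ne, sub_zero] at this
  have hsuff : KernelCondition n K → ∀ q : ℝ≥0∞, 1 ≤ q → IsBAP n q (hadamard K) := by
    rintro ⟨hO, hre⟩ q hq
    have h := (isBigO_pow_iff_taylorCoeff hd (2 * n + 1)).1 hO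
    refine isBAP_hadamard hK (fun k hk hkn => ?_) hK1 hre hq
    have := h k (by omega)
    rwa [hcoeff, if_neg hkn, sub_zero] at this
  refine ⟨⟨fun h => ⟨?_, fun z hz hz0 => h.half_le_re hK hKlow hK1 hz hz0⟩,
    fun h => hsuff h ∞ le_top⟩, hsuff⟩
  rw [isBigO_pow_iff_taylorCoeff hd]
  intro k hk
  rw [hcoeff]
  rcases lt_trichotomy k n with hkn | rfl | hkn
  · rw [hKlow k hkn, if_neg hkn.ne, sub_zero]
  · rw [hK1, if_pos rfl, sub_self]
  -- Here `n < k ≤ 2n`, so the offset `j + 1` lies between `1` and `n`.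
  · obtain ⟨j, rfl⟩ := Nat.exists_eq_add_of_lt hkn
    rw [add_assoc, h.taylorCoeff_eq_zero hK hKlow hK1 (by omega) (by omega), if_neg (by omega),
      sub_zero]
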